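/- Throughout, $\mathbb R^n$ carries the Euclidean inner product $\langle\cdot,\cdot\rangle$ and norm $\|\cdot\|$ (also $\mathbb R^n\times\mathbb R^n$, as a product). A function $f:\mathbb R^n\to\mathbb R$ is *lower-$\mathcal C^2$* if every $\bar x\in\mathbb R^n$ has an open neighborhood $V$ on which $f(x)=\max_{t\in T}f_t(x)$, where $T$ is a compact topological space, each $f_t$ is of class $\mathcal C^2$ on $V$, and $f_t(x)$ and all its partial derivatives in $x$ through order $2$ depend continuously on $(t,x)\in T\times V$. It is *strongly convex with modulus* $\kappa$ if $f(\lambda x+(1-\lambda)y)\le\lambda f(x)+(1-\lambda)f(y)-\frac{\kappa}{2}\lambda(1-\lambda)\|x-y\|^2$ for all $x,y\in\mathbb R^n$, $\lambda\in(0,1)$. For an extended-real-valued function $\varphi$ on a Euclidean space and $\bar u$ with $\varphi(\bar u)$ finite, let $$\widehat\partial\varphi(\bar u)=\Big\{v:\ \liminf_{u\to\bar u,\ u\neq\bar u}\frac{\varphi(u)-\varphi(\bar u)-\langle v,u-\bar u\rangle}{\|u-\bar u\|}\ge0\Big\},$$ and $\widehat\partial\varphi(\bar u)=\emptyset$ if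 $\varphi(\bar u)$ is not finite. The limiting subdifferential $\partial\varphi(\bar u)$ is the set of limits of sequences $v_k\in\widehat\partial\varphi(u_k)$ with $u_k\to\bar u$ and $\varphi(u_k)\to\varphi(\bar u)$. The regular normal cone to a set $\Omega$ at $\bar u$ is $\widehat N(\bar u;\Omega)=\widehat\partial\delta(\cdot;\Omega)(\bar u)$, where $\delta(\cdot;\Omega)$ is $0$ on $\Omega$ and $\infty$ off $\Omega$. For a set-valued mapping $F$ from $\mathbb R^n$ to $\mathbb R^n$ with graph $\operatorname{gph}F=\{(u,v): v\in F(u)\}$, the regular coderivative is $\widehat D^*F(u,v)(w)=\{z:(z,-w)\in\widehat N((u,v);\operatorname{gph}F)\}$, and the limiting coderivative $D^*F(\bar u,\bar v)(w)$ is the set of limits of sequences $z_k\in\widehat D^*F(u_k,v_k)(w_k)$ with $(u_k,v_k)\to(\bar u,\bar v)$ and $w_k\to w$. The second-order subdifferential and the combined second-order subdifferential of $f$ at $(u,v)\in\operatorname{gph}\partial f$ are $$\partial^2f(u,v)(w)=(D^*\partial f)(u,v)(w),\qquad \breve\partial^2f(u,v)(w)=(\widehat D^*\partial f)(u,v)(w).$$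 **Corollary 4.3.** Let $f:\mathbb R^n\to\mathbb R$ be lower-$\mathcal C^2$ and let $\kappa>0$. Then the following are equivalent: (i) $f$ is strongly convex on $\mathbb R^n$ with modulus $\kappa$. (ii) $\langle z,w\rangle\ge\kappa\|w\|^2$ for all $z\in\partial^2f(u,v)(w)$, $(u,v)\in\operatorname{gph}\partial f$, $w\in\mathbb R^n$. (iii) $\langle z,w\rangle\ge\kappa\|w\|^2$ for all $z\in\breve\partial^2f(u,v)(w)$, $(u,v)\in\operatorname{gph}\partial f$, $w\in\mathbb R^n$. -/

import Mathlib

open Filter Topology Set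

noncomputable section

namespace VarAnalysis

/-- `f` is lower-`C^k`: around every point `x₀` there are an open neighbourhood `V`, a compact
space `T` and functions `F t`, `t ∈ T`, of class `C^k` on `V`, whose derivatives in `x` up to
order `k` depend continuously on `(t, x) ∈ T × V`, with `f x = max_{t ∈ T} F t x` on `V`. -/
def IsLowerC {X : Type*} [NormedAddCommGroup X] [NormedSpace ℝ X] (k : ℕ) (f : X → ℝ) : Prop :=
  ∀ x₀ : X, ∃ V : Set X, IsOpen V ∧ x₀ ∈ V ∧
    ∃ (T : Type) (_ : TopologicalSpace T) (_ : CompactSpace T) (F : T → X → ℝ),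
      (∀ t, ContDiffOn ℝ k (F t) V) ∧
      (∀ j ≤ k, ContinuousOn (fun p : T × X => iteratedFDeriv ℝ j (F p.1) p.2)
        ((univ : Set T) ×ˢ V)) ∧
      ∀ x ∈ V, IsGreatest (range fun t => F t x) (f x)

section Constructions

variable {X : Type*} [NormedAddCommGroup X] [InnerProductSpace ℝ X]

/-- The regular (Fréchet) subdifferential of an extended-real-valued function; it is empty at
points where the function is not finite. -/
def regularSubdiff (f : X → EReal) (u₀ : X) : Set X :=
  {v | f u₀ ≠ ⊤ ∧ f u₀ ≠ ⊥ ∧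
    0 ≤ liminf (fun u => (f u - f u₀ - ((inner ℝ v (u - u₀) : ℝ) : EReal)) /
      ((‖u - u₀‖ : ℝ) : EReal)) (𝓝[≠] u₀)}

/-- The limiting (Mordukhovich) subdifferential in finite dimensions (where weak and strong
convergence agree): limits of regular subgradients `v k` at points `u k → u₀` with
`f (u k) → f u₀`. It is empty at points where the function is not finite. -/
def limitingSubdiff [FiniteDimensional ℝ X] (f : X → EReal) (u₀ : X) : Set X :=
  {v₀ | f u₀ ≠ ⊤ ∧ f u₀ ≠ ⊥ ∧ ∃ u v : ℕ → X,
    Tendsto u atTop (𝓝 u₀) ∧ Tendsto (fun k => f (u k)) atTop (𝓝 (f u₀)) ∧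
    Tendsto v atTop (𝓝 v₀) ∧ ∀ k, v k ∈ regularSubdiff f (u k)}

open Classical in
/-- The indicator function of a set: `0` on the set, `∞` off it. -/
def indicatorFn (Ω : Set X) (u : X) : EReal := if u ∈ Ω then 0 else ⊤

/-- The regular normal cone (empty at points outside `Ω`). -/
def regularNormalCone (Ω : Set X) (u₀ : X) : Set X := regularSubdiff (indicatorFn Ω) u₀

/-- The graph of a set-valued mapping, in `X × X` with the Hilbert product structure. -/
def gph (F : X → Set X) : Set (WithLp 2 (X × X)) := {p | p.snd ∈ F p.fst}

/-- The regular coderivative of `F` at `(u, v)`, applied to `w`. -/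
def regularCoderiv (F : X → Set X) (u v w : X) : Set X :=
  {z | WithLp.toLp 2 (z, -w) ∈ regularNormalCone (gph F) (WithLp.toLp 2 (u, v))}

/-- The limiting coderivative of `F` at `(u₀, v₀)`, applied to `w₀`, in finite dimensions:
the sequential outer limit of `regularCoderiv F u v w` as `(u, v) → (u₀, v₀)`, `w → w₀`. -/
def limitingCoderiv [FiniteDimensional ℝ X] (F : X → Set X) (u₀ v₀ w₀ : X) : Set X :=
  {z₀ | ∃ u v w z : ℕ → X,
    Tendsto u atTop (𝓝 u₀) ∧ Tendsto v atTop (𝓝 v₀) ∧ Tendsto w atTop (𝓝 w₀) ∧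
    Tendsto z atTop (𝓝 z₀) ∧ ∀ k, z k ∈ regularCoderiv F (u k) (v k) (w k)}

variable [FiniteDimensional ℝ X]

/-- The limiting subdifferential mapping `∂f` of a real-valued function. -/
def subdiff (f : X → ℝ) : X → Set X := limitingSubdiff fun x => (f x : EReal)

/-- The second-order subdifferential `∂²f(u, v)(w) = (D^*∂f)(u, v)(w)`. -/
def secondSubdiff (f : X → ℝ) (u v w : X) : Set X := limitingCoderiv (subdiff f) u v w

/-- The combined second-order subdifferential, the regular coderivative of `∂f`. -/
def combinedSecondSubdiff (f : X → ℝ) (u v w : X) : Set X := regularCoderiv (subdiff f) u v w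

end Constructions

end VarAnalysis

end

/-!
The proof works with limiting subgradients only through subgradient inequalities. A lower-`C²`
function has at every point a quadratic minorant of locally uniform curvature, so it is locally
weakly convex; on each ball all limiting subgradients then satisfy
`f u + ⟪v, x - u⟫ - ρ * ‖x - u‖ ^ 2 ≤ f x` with one constant `ρ`
(`IsLowerC.exists_support_closedBall`).

The conditions on the two coderivatives are equivalent because the limiting coderivative consists
of limits of elements of regular ones, and the inequality passes to the limit.

Strong convexity gives the bound on the regular coderivative
(`StrongConvexOn.le_inner_of_mem_combinedSecondSubdiff`): for `c > -κ` the mapping `∂f + c • id` is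
onto, so the graph of `∂f` contains points near `(u, v)` whose increments `a`, `b` satisfy
`b + c • a = t • (z + c • w)`; at these the normal inequality becomes `0 ≤ ⟪z + c • w, w⟫` in the
limit `t → 0`.

Conversely (`inner_sub_subdiff_of_le_inner_combinedSecondSubdiff`), consider the coordinates
`y = u + lam • v` and `N = (2 + 2 * κ * lam) • u - y` on the graph of `∂f`. Strong monotonicity of
`∂f` with constant `κ` means that `N` is nonexpansive as a function of `y`, and the coderivative
bound means that the regular subgradients of `⟪q, N⟫` with respect to `y` have norm at most `‖q‖`.
A mean value argument leads from one to the other: if two points violate nonexpansiveness, then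
`⟪q, N⟫` plus a penalty in `‖y - y₀‖` of slope greater than `‖q‖` has an interior minimum on a
compact part of the graph, at a point where the penalty is differentiable; there `⟪q, N⟫` would
have a regular subgradient of norm greater than `‖q‖`. Small `lam` makes `y` determine `u`, by weak
convexity. Finally, strong monotonicity and weak convexity give the subgradient inequality of a
strongly convex function by summation over fine subdivisions of a segment
(`le_of_inner_sub_subdiff`), and that inequality implies strong convexity.
-/

namespace VarAnalysis

/-! ### Subgradients and normals without extended reals -/

section Characterisations

variable {X : Type*} [NormedAddCommGroup X] [InnerProductSpace ℝ X]

theorem le_of_forall_pos_le_add_mul {a b C : ℝ} (h : ∀ η : ℝ, 0 < η → a ≤ b + η * C) : a ≤ b := by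
  have hlim : Tendsto (fun η : ℝ => b + η * C) (𝓝[>] 0) (𝓝 b) := by
    have : Continuous fun η : ℝ => b + η * C := by fun_prop
    simpa using (this.tendsto 0).mono_left nhdsWithin_le_nhds
  exact ge_of_tendsto hlim (eventually_mem_nhdsWithin.mono fun η hη => h η hη)

theorem norm_toLp_prod_le {X : Type*} [NormedAddCommGroup X] (a b : X) :
    ‖WithLp.toLp 2 (a, b)‖ ≤ ‖a‖ + ‖b‖ := by
  refine le_of_sq_le_sq ?_ (by positivity)
  rw [WithLp.prod_norm_sq_eq_of_L2]
  have := mul_nonneg (norm_nonneg a) (norm_nonneg b)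
  change ‖a‖ ^ 2 + ‖b‖ ^ 2 ≤ _
  nlinarith

/-- The form in which an `EReal`-valued `liminf` condition is used: nonnegativity of the lower
limit, tested on the negative reals. -/
theorem zero_le_liminf_iff {α : Type*} {F : Filter α} {g : α → EReal} :
    0 ≤ liminf g F ↔ ∀ η : ℝ, 0 < η → ∀ᶠ a in F, ((-η : ℝ) : EReal) ≤ g a := by
  rw [le_liminf_iff]
  constructor
  · intro h η hη
    refine (h ((-η : ℝ) : EReal) ?_).mono fun a ha => ha.le
    exact_mod_cast neg_neg_of_pos hη
  · intro h y hy
    obtain ⟨r, hyr, hr⟩ := EReal.lt_iff_exists_real_btwn.1 hy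
    have hr' : r < 0 := by exact_mod_cast hr
    refine (h (-r) (by linarith)).mono fun a ha => hyr.trans_le ?_
    simpa using ha

/-- Regular subgradients of a real-valued function, without extended reals. -/
theorem mem_regularSubdiff_coe_iff {f : X → ℝ} {u₀ v : X} :
    v ∈ regularSubdiff (fun x => (f x : EReal)) u₀ ↔ ∀ η : ℝ, 0 < η → ∀ᶠ u in 𝓝 u₀,
      f u₀ + inner ℝ v (u - u₀) - η * ‖u - u₀‖ ≤ f u := by
  simp only [regularSubdiff, mem_ofPred_eq, ne_eq, EReal.coe_ne_top, not_false_eq_true,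
    EReal.coe_ne_bot, true_and, zero_le_liminf_iff, eventually_nhdsWithin_iff]
  refine forall₂_congr fun η hη => eventually_congr (Eventually.of_forall fun u => ?_)
  rcases eq_or_ne u u₀ with rfl | hu
  · simp
  have hpos : 0 < ‖u - u₀‖ := norm_pos_iff.2 (sub_ne_zero.2 hu)
  rw [← EReal.coe_sub, ← EReal.coe_sub, ← EReal.coe_div, EReal.coe_le_coe_iff, le_div_iff₀ hpos]
  simp only [mem_compl_iff, mem_singleton_iff, hu, not_false_eq_true, forall_const]
  constructor <;> intro h <;> linarith

/-- Regular normals, without extended reals. -/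
theorem mem_regularNormalCone_iff {Ω : Set X} {u₀ v : X} :
    v ∈ regularNormalCone Ω u₀ ↔ u₀ ∈ Ω ∧ ∀ η : ℝ, 0 < η → ∀ᶠ u in 𝓝 u₀,
      u ∈ Ω → inner ℝ v (u - u₀) ≤ η * ‖u - u₀‖ := by
  unfold regularNormalCone regularSubdiff
  by_cases h₀ : u₀ ∈ Ω
  swap
  · simp [indicatorFn, h₀]
  simp only [mem_ofPred_eq, zero_le_liminf_iff, eventually_nhdsWithin_iff]
  simp only [indicatorFn, h₀, if_true, true_and, ne_eq, EReal.zero_ne_top, not_false_eq_true,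
    EReal.zero_ne_bot]
  refine forall₂_congr fun η hη => eventually_congr (Eventually.of_forall fun u => ?_)
  rcases eq_or_ne u u₀ with rfl | hu
  · simp
  have hpos : 0 < ‖u - u₀‖ := norm_pos_iff.2 (sub_ne_zero.2 hu)
  simp only [mem_compl_iff, mem_singleton_iff, hu, not_false_eq_true, forall_const]
  by_cases hΩ : u ∈ Ω
  · simp only [hΩ, if_true, forall_const]
    rw [sub_zero, zero_sub, ← EReal.coe_neg, ← EReal.coe_div, EReal.coe_le_coe_iff,
      le_div_iff₀ hpos]
    constructor <;> intro h <;> linarith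
  · simp only [hΩ, if_false, false_imp_iff, iff_true]
    rw [sub_zero, EReal.top_sub_coe, EReal.top_div_of_pos_ne_top (by exact_mod_cast hpos)
      (EReal.coe_ne_top _)]
    exact le_top

/-- Regular coderivatives, without extended reals and with the product inner product expanded. -/
theorem mem_regularCoderiv_iff {F : X → Set X} {u v w z : X} :
    z ∈ regularCoderiv F u v w ↔ v ∈ F u ∧ ∀ η : ℝ, 0 < η →
      ∀ᶠ p in 𝓝 (WithLp.toLp 2 (u, v)), p.snd ∈ F p.fst →
        inner ℝ z (p.fst - u) - inner ℝ w (p.snd - v) ≤ η * ‖p - WithLp.toLp 2 (u, v)‖ := by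
  rw [regularCoderiv, mem_ofPred_eq, mem_regularNormalCone_iff]
  refine and_congr Iff.rfl (forall₂_congr fun η hη =>
    eventually_congr (Eventually.of_forall fun p => ?_))
  simp only [WithLp.prod_inner_apply, inner_neg_left, ← sub_eq_add_neg]
  exact Iff.rfl

variable [FiniteDimensional ℝ X]

theorem regularSubdiff_subset_subdiff {f : X → ℝ} {u : X} :
    regularSubdiff (fun x => (f x : EReal)) u ⊆ subdiff f u := fun v hv =>
  ⟨EReal.coe_ne_top _, EReal.coe_ne_bot _, fun _ => u, fun _ => v, tendsto_const_nhds,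
    tendsto_const_nhds, tendsto_const_nhds, fun _ => hv⟩

/-- A quadratic minorant that touches `f` at `u` has a subgradient of `f` as its slope. -/
theorem mem_subdiff_of_eventually_support {f : X → ℝ} {u v : X} {m : ℝ}
    (h : ∀ᶠ x in 𝓝 u, f u + inner ℝ v (x - u) + m * ‖x - u‖ ^ 2 ≤ f x) : v ∈ subdiff f u := by
  refine regularSubdiff_subset_subdiff (mem_regularSubdiff_coe_iff.2 fun η hη => ?_)
  have ht : Tendsto (fun x : X => |m| * ‖x - u‖) (𝓝 u) (𝓝 0) := by
    have : Continuous fun x : X => |m| * ‖x - u‖ := by fun_prop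
    simpa using this.tendsto u
  filter_upwards [h, ht.eventually (gt_mem_nhds hη)] with x hx hx'
  have h1 : -(η * ‖x - u‖) ≤ m * ‖x - u‖ ^ 2 := by
    have := mul_le_mul_of_nonneg_right hx'.le (norm_nonneg (x - u))
    have := mul_le_mul_of_nonneg_right (neg_abs_le m) (sq_nonneg ‖x - u‖)
    nlinarith
  linarith

end Characterisations

/-! ### Subgradient inequalities and strong convexity -/

section Support

variable {X : Type*} [NormedAddCommGroup X] [InnerProductSpace ℝ X]

/-- A function with a quadratic minorant of curvature `m` at each point of a convex set is strongly
convex there with modulus `m`, which may be negative. -/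
theorem strongConvexOn_of_support {s : Set X} {f : X → ℝ} {m : ℝ} (hs : Convex ℝ s)
    (h : ∀ z ∈ s, ∃ g : X, ∀ x ∈ s, f z + inner ℝ g (x - z) + m / 2 * ‖x - z‖ ^ 2 ≤ f x) :
    StrongConvexOn s m f := by
  refine ⟨hs, fun x hx y hy a b ha hb hab => ?_⟩
  obtain ⟨g, hg⟩ := h (a • x + b • y) (hs hx hy ha hb hab)
  have h1 := hg x hx
  have h2 := hg y hy
  have e1 : x - (a • x + b • y) = b • (x - y) := by
    obtain rfl : a = 1 - b := by linarith
    module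
  have e2 : y - (a • x + b • y) = (-a) • (x - y) := by
    obtain rfl : b = 1 - a := by linarith
    module
  rw [e1, inner_smul_right, norm_smul, mul_pow, Real.norm_eq_abs, sq_abs] at h1
  rw [e2, inner_smul_right, norm_smul, mul_pow, Real.norm_eq_abs, sq_abs] at h2
  have h1' := mul_le_mul_of_nonneg_left h1 ha
  have h2' := mul_le_mul_of_nonneg_left h2 hb
  simp only [smul_eq_mul]
  obtain rfl : b = 1 - a := by linarith
  nlinarith

/-- The subgradient inequality at a regular subgradient: the defining estimate is applied along the
segment from `u` to `x`. -/
theorem _root_.StrongConvexOn.le_of_mem_regularSubdiff {s : Set X} {f : X → ℝ} {m : ℝ}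
    (hf : StrongConvexOn s m f) {u v x : X} (hu : u ∈ s) (hx : x ∈ s)
    (hv : v ∈ regularSubdiff (fun x => (f x : EReal)) u) :
    f u + inner ℝ v (x - u) + m / 2 * ‖x - u‖ ^ 2 ≤ f x := by
  rw [mem_regularSubdiff_coe_iff] at hv
  have key : ∀ η : ℝ, 0 < η →
      f u + inner ℝ v (x - u) - η * ‖x - u‖ + m / 2 * ‖x - u‖ ^ 2 ≤ f x := by
    intro η hη
    have hc : Tendsto (fun t : ℝ => u + t • (x - u)) (𝓝[>] 0) (𝓝 u) := by
      have : Continuous fun t : ℝ => u + t • (x - u) := by fun_prop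
      simpa using (this.tendsto 0).mono_left nhdsWithin_le_nhds
    have hlim : Tendsto (fun t : ℝ => f u + inner ℝ v (x - u) - η * ‖x - u‖ +
        (1 - t) * (m / 2 * ‖x - u‖ ^ 2)) (𝓝[>] 0)
        (𝓝 (f u + inner ℝ v (x - u) - η * ‖x - u‖ + m / 2 * ‖x - u‖ ^ 2)) := by
      have : Continuous fun t : ℝ => f u + inner ℝ v (x - u) - η * ‖x - u‖ +
        (1 - t) * (m / 2 * ‖x - u‖ ^ 2) := by fun_prop
      simpa using (this.tendsto 0).mono_left nhdsWithin_le_nhds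
    refine le_of_tendsto hlim ?_
    filter_upwards [hc.eventually (hv η hη), self_mem_nhdsWithin,
      mem_nhdsWithin_of_mem_nhds (gt_mem_nhds (zero_lt_one' ℝ))] with t ht ht0 ht1
    have ht0 : 0 < t := ht0
    have ht1 : t < 1 := ht1
    have h2 := hf.2 hx hu ht0.le (sub_nonneg.2 ht1.le) (by ring)
    have e : t • x + (1 - t) • u = u + t • (x - u) := by module
    rw [e] at h2
    rw [add_sub_cancel_left, inner_smul_right, norm_smul, Real.norm_eq_abs,
      abs_of_pos ht0] at ht
    simp only [smul_eq_mul] at h2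
    refine le_of_mul_le_mul_left ?_ ht0
    linarith
  refine le_of_forall_pos_le_add_mul (C := ‖x - u‖) fun η hη => ?_
  have := key η hη
  linarith

/-- The subgradient inequality at limiting subgradients. -/
theorem _root_.StrongConvexOn.le_of_mem_subdiff [FiniteDimensional ℝ X] {s : Set X} {f : X → ℝ}
    {m : ℝ} (hf : StrongConvexOn s m f) {u v x : X} (hu : s ∈ 𝓝 u) (hx : x ∈ s)
    (hv : v ∈ subdiff f u) :
    f u + inner ℝ v (x - u) + m / 2 * ‖x - u‖ ^ 2 ≤ f x := by
  obtain ⟨-, -, U, V, hU, hfU, hV, hUV⟩ := hv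
  have hfU' : Tendsto (fun k => f (U k)) atTop (𝓝 (f u)) := EReal.tendsto_coe.1 hfU
  have hxU : Tendsto (fun k => x - U k) atTop (𝓝 (x - u)) := tendsto_const_nhds.sub hU
  have hlim := (hfU'.add (hV.inner (𝕜 := ℝ) hxU)).add ((hxU.norm.pow 2).const_mul (m / 2))
  refine le_of_tendsto hlim ((hU.eventually_mem hu).mono fun k hk => ?_)
  exact hf.le_of_mem_regularSubdiff hk hx (hUV k)

theorem _root_.StrongConvexOn.continuousOn [FiniteDimensional ℝ X] {s : Set X} {f : X → ℝ} {m : ℝ}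
    (hf : StrongConvexOn s m f) (hs : IsOpen s) : ContinuousOn f s := by
  have h := (strongConvexOn_iff_convex.1 hf).continuousOn hs
  have h2 : ContinuousOn (fun x : X => m / 2 * ‖x‖ ^ 2) s := by fun_prop
  refine (h.add h2).congr fun x _ => ?_
  simp

end Support

/-! ### Lower-`C²` functions -/

section LowerC2

variable {X : Type*} [NormedAddCommGroup X] [InnerProductSpace ℝ X]

/-- A first-order Taylor estimate with a bound on the second derivative. -/
theorem le_of_norm_iteratedFDeriv_two_le {F : X → ℝ} {V s : Set X} (hV : IsOpen V)
    (hF : ContDiffOn ℝ 2 F V) (hs : Convex ℝ s) (hsV : s ⊆ V) {C : ℝ}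
    (hC : ∀ x ∈ s, ‖iteratedFDeriv ℝ 2 F x‖ ≤ C) {x y : X} (hx : x ∈ s) (hy : y ∈ s) :
    F x + fderiv ℝ F x (y - x) - C * ‖y - x‖ ^ 2 ≤ F y := by
  have hC0 : 0 ≤ C := (norm_nonneg _).trans (hC x hx)
  have hd : ∀ z ∈ s, DifferentiableAt ℝ F z := fun z hz =>
    (hF.differentiableOn (by norm_num)).differentiableAt (hV.mem_nhds (hsV hz))
  have hd' : ∀ z ∈ s, DifferentiableAt ℝ (fderiv ℝ F) z := fun z hz =>
    ((hF.fderiv_of_isOpen (m := 1) hV (by norm_num)).differentiableOn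
      (by norm_num)).differentiableAt (hV.mem_nhds (hsV hz))
  have hbd : ∀ z ∈ s, ‖fderiv ℝ (fderiv ℝ F) z‖ ≤ C := fun z hz => by
    rw [← norm_iteratedFDeriv_one, norm_iteratedFDeriv_fderiv]
    exact hC z hz
  have hseg : segment ℝ x y ⊆ s := hs.segment_subset hx hy
  have h1 : ∀ z ∈ segment ℝ x y, ‖fderiv ℝ F z - fderiv ℝ F x‖ ≤ C * ‖y - x‖ := fun z hz =>
    (hs.norm_image_sub_le_of_norm_fderiv_le hd' hbd hx (hseg hz)).trans
      (mul_le_mul_of_nonneg_left (norm_sub_le_of_mem_segment hz) hC0)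
  have h2 := (convex_segment x y).norm_image_sub_le_of_norm_fderiv_le'
    (fun z hz => hd z (hseg hz)) h1 (left_mem_segment ℝ x y) (right_mem_segment ℝ x y)
  have h3 := neg_le_of_abs_le (Real.norm_eq_abs _ ▸ h2)
  nlinarith

/-- A lower-`C²` function has, on a ball around each point, a quadratic minorant of a common
curvature at every point: the second derivatives of the functions of which it is the maximum
are bounded on a compact set, and a function attaining the maximum has the minorant. -/
theorem IsLowerC.exists_support_ball [FiniteDimensional ℝ X] {f : X → ℝ} (hf : IsLowerC 2 f)
    (x₀ : X) : ∃ δ > 0, ∃ m : ℝ, ∀ z ∈ Metric.ball x₀ δ, ∃ g : X, ∀ x ∈ Metric.ball x₀ δ,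
      f z + inner ℝ g (x - z) + m / 2 * ‖x - z‖ ^ 2 ≤ f x := by
  obtain ⟨V, hVo, hx₀, T, _, _, F, hF, hcont, hmax⟩ := hf x₀
  obtain ⟨δ, hδ, hδV⟩ := Metric.nhds_basis_closedBall.mem_iff.1 (hVo.mem_nhds hx₀)
  have hcpt : IsCompact ((univ : Set T) ×ˢ Metric.closedBall x₀ δ) :=
    isCompact_univ.prod (isCompact_closedBall x₀ δ)
  obtain ⟨C, hC⟩ := hcpt.exists_bound_of_continuousOn
    ((hcont 2 le_rfl).mono (prod_mono subset_rfl hδV))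
  have hball := Metric.ball_subset_closedBall (x := x₀) (ε := δ)
  refine ⟨δ, hδ, -2 * C, fun z hz => ?_⟩
  obtain ⟨t, ht⟩ := (hmax z (hδV (hball hz))).1
  refine ⟨(InnerProductSpace.toDual ℝ X).symm (fderiv ℝ (F t) z), fun x hx => ?_⟩
  have h1 := le_of_norm_iteratedFDeriv_two_le hVo (hF t) (convex_closedBall x₀ δ) hδV
    (fun y hy => hC (t, y) ⟨mem_univ t, hy⟩) (hball hz) (hball hx)
  have h2 : F t x ≤ f x := (hmax x (hδV (hball hx))).2 ⟨t, rfl⟩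
  have ht : F t z = f z := ht
  rw [InnerProductSpace.toDual_symm_apply]
  linarith

/-- A vector satisfying the subgradient inequality at `x` on a ball around `x` is bounded in terms of
a bound for the function: the inequality is tested at the boundary of the ball, in the direction of
the vector. -/
theorem norm_le_of_support {f : X → ℝ} {x v : X} {δ M m : ℝ} (hδ : 0 < δ)
    (hM : ∀ y ∈ Metric.closedBall x δ, |f y| ≤ M)
    (h : ∀ y ∈ Metric.closedBall x δ, f x + inner ℝ v (y - x) - m * ‖y - x‖ ^ 2 ≤ f y) :
    ‖v‖ ≤ (2 * M + |m| * δ ^ 2) / δ := by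
  have hM0 : 0 ≤ M := (abs_nonneg _).trans (hM x (Metric.mem_closedBall_self hδ.le))
  rcases eq_or_ne v 0 with rfl | hv
  · rw [norm_zero]; positivity
  have hv' : 0 < ‖v‖ := norm_pos_iff.2 hv
  have hn : ‖(δ / ‖v‖) • v‖ = δ := by
    rw [norm_smul, Real.norm_eq_abs, abs_of_pos (div_pos hδ hv'), div_mul_cancel₀ _ hv'.ne']
  have hy : x + (δ / ‖v‖) • v ∈ Metric.closedBall x δ := by
    rw [mem_closedBall_iff_norm, add_sub_cancel_left, hn]
  have h1 := h _ hy
  rw [add_sub_cancel_left, hn, inner_smul_right, real_inner_self_eq_norm_sq] at h1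
  have h2 : δ / ‖v‖ * ‖v‖ ^ 2 = ‖v‖ * δ := by field_simp
  rw [h2] at h1
  have h3 := abs_le.1 (hM _ hy)
  have h4 := abs_le.1 (hM x (Metric.mem_closedBall_self hδ.le))
  have h5 := mul_le_mul_of_nonneg_right (le_abs_self m) (sq_nonneg δ)
  rw [le_div_iff₀ hδ]
  linarith

variable [FiniteDimensional ℝ X] {f : X → ℝ}

theorem IsLowerC.subdiff_nonempty (hf : IsLowerC 2 f) (x : X) : (subdiff f x).Nonempty := by
  obtain ⟨δ, hδ, m, h⟩ := hf.exists_support_ball x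
  obtain ⟨g, hg⟩ := h x (Metric.mem_ball_self hδ)
  exact ⟨g, mem_subdiff_of_eventually_support
    (eventually_of_mem (Metric.ball_mem_nhds x hδ) hg)⟩

/-- A lower-`C²` function is locally weakly convex. -/
theorem IsLowerC.exists_strongConvexOn_ball (hf : IsLowerC 2 f) (x₀ : X) :
    ∃ δ > 0, ∃ m : ℝ, StrongConvexOn (Metric.ball x₀ δ) m f := by
  obtain ⟨δ, hδ, m, h⟩ := hf.exists_support_ball x₀
  exact ⟨δ, hδ, m, strongConvexOn_of_support (convex_ball x₀ δ) h⟩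

theorem IsLowerC.continuous (hf : IsLowerC 2 f) : Continuous f := by
  refine continuous_iff_continuousAt.2 fun x => ?_
  obtain ⟨δ, hδ, m, h⟩ := hf.exists_strongConvexOn_ball x
  exact (h.continuousOn Metric.isOpen_ball).continuousAt (Metric.ball_mem_nhds x hδ)

/-- On a ball of any radius a lower-`C²` function satisfies the subgradient inequality of a weakly
convex function, with one constant. Near the diagonal this is local weak convexity; away from
it, the quadratic term absorbs the bounded remaining terms. -/
theorem IsLowerC.exists_support_closedBall (hf : IsLowerC 2 f) (R : ℝ) :
    ∃ ρ > 0, ∀ u ∈ Metric.closedBall (0 : X) R, ∀ v ∈ subdiff f u,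
      ∀ x ∈ Metric.closedBall (0 : X) R,
        f u + inner ℝ v (x - u) - ρ * ‖x - u‖ ^ 2 ≤ f x := by
  have hmono : ∀ {ρ ρ' : ℝ} {u v x : X}, ρ ≤ ρ' →
      f u + inner ℝ v (x - u) - ρ * ‖x - u‖ ^ 2 ≤ f x →
      f u + inner ℝ v (x - u) - ρ' * ‖x - u‖ ^ 2 ≤ f x := by
    intro ρ ρ' u v x hρ h
    have := mul_le_mul_of_nonneg_right hρ (sq_nonneg ‖x - u‖)
    exact le_trans (sub_le_sub_left this _) h
  refine (isCompact_closedBall (0 : X) R).induction_on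
    (p := fun s => ∃ ρ > 0, ∀ u ∈ s, ∀ v ∈ subdiff f u, ∀ x ∈ Metric.closedBall (0 : X) R,
      f u + inner ℝ v (x - u) - ρ * ‖x - u‖ ^ 2 ≤ f x) ⟨1, one_pos, by simp⟩ ?_ ?_ ?_
  · rintro s t hst ⟨ρ, hρ, h⟩
    exact ⟨ρ, hρ, fun u hu => h u (hst hu)⟩
  · rintro s t ⟨ρ, hρ, h⟩ ⟨ρ', -, h'⟩
    refine ⟨max ρ ρ', lt_max_of_lt_left hρ, fun u hu v hv x hx => ?_⟩
    rcases hu with hu | hu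
    · exact hmono (le_max_left _ _) (h u hu v hv x hx)
    · exact hmono (le_max_right _ _) (h' u hu v hv x hx)
  · intro x₀ _
    obtain ⟨δ, hδ, m, hm⟩ := hf.exists_strongConvexOn_ball x₀
    obtain ⟨M, hM⟩ := ((isCompact_closedBall (0 : X) R).union
      (isCompact_closedBall x₀ δ)).exists_bound_of_continuousOn hf.continuous.continuousOn
    simp only [Real.norm_eq_abs] at hM
    -- Subgradients at points of the ball of radius `δ / 2` are tested on balls of radius `δ / 4`.
    set B := (2 * M + |(-(m / 2))| * (δ / 4) ^ 2) / (δ / 4) with hB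
    set r := δ / 2 with hr
    have hr0 : 0 < r := by positivity
    refine ⟨Metric.ball x₀ r, mem_nhdsWithin_of_mem_nhds (Metric.ball_mem_nhds x₀ hr0),
      max 1 (max (-(m / 2)) (2 * (|M| / r ^ 2) + |B| / r)), lt_max_of_lt_left one_pos,
      fun u hu v hv x hx => ?_⟩
    have huδ : u ∈ Metric.ball x₀ δ := Metric.ball_subset_ball (by linarith) hu
    have hsup : ∀ y ∈ Metric.ball x₀ δ,
        f u + inner ℝ v (y - u) - -(m / 2) * ‖y - u‖ ^ 2 ≤ f y := fun y hy => by
      have := hm.le_of_mem_subdiff (Metric.isOpen_ball.mem_nhds huδ) hy hv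
      linarith
    by_cases hxδ : x ∈ Metric.ball x₀ δ
    · exact hmono ((le_max_left _ _).trans (le_max_right _ _)) (hsup x hxδ)
    refine hmono ((le_max_right _ _).trans (le_max_right _ _)) ?_
    have hsub : Metric.closedBall u (δ / 4) ⊆ Metric.ball x₀ δ := fun y hy => by
      have h1 := Metric.mem_closedBall.1 hy
      have h2 := Metric.mem_ball.1 hu
      have h3 := dist_triangle y u x₀
      rw [Metric.mem_ball]
      linarith
    have hvB : ‖v‖ ≤ B := norm_le_of_support (by positivity)
      (fun y hy => hM y (Or.inr (Metric.ball_subset_closedBall (hsub hy))))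
      (fun y hy => hsup y (hsub hy))
    have hdist : r ≤ ‖x - u‖ := by
      have h1 : δ ≤ dist x x₀ := not_lt.1 hxδ
      have h2 := Metric.mem_ball.1 hu
      have h3 := dist_triangle x u x₀
      rw [← dist_eq_norm]
      linarith
    have h1 := abs_le.1 (hM x (Or.inl hx))
    have h2 := abs_le.1 (hM u (Or.inr (Metric.ball_subset_closedBall huδ)))
    have h3 : inner ℝ v (x - u) ≤ |B| * ‖x - u‖ := (real_inner_le_norm _ _).trans
      (mul_le_mul_of_nonneg_right (hvB.trans (le_abs_self B)) (norm_nonneg _))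
    have h4 : |M| ≤ |M| / r ^ 2 * ‖x - u‖ ^ 2 := by
      rw [div_mul_eq_mul_div, le_div_iff₀ (by positivity)]
      exact mul_le_mul_of_nonneg_left (pow_le_pow_left₀ hr0.le hdist 2) (abs_nonneg M)
    have h5 : |B| * ‖x - u‖ ≤ |B| / r * ‖x - u‖ ^ 2 := by
      rw [div_mul_eq_mul_div, le_div_iff₀ hr0, mul_assoc, sq]
      exact mul_le_mul_of_nonneg_left
        (mul_le_mul_of_nonneg_left hdist (norm_nonneg _)) (abs_nonneg B)
    have h6 := le_abs_self M
    rw [add_mul, mul_assoc]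
    linarith

end LowerC2

/-! ### From strong convexity to the coderivative bound -/

section Necessity

variable {X : Type*} [NormedAddCommGroup X] [InnerProductSpace ℝ X] [FiniteDimensional ℝ X]
  {f : X → ℝ} {κ : ℝ}

theorem _root_.StrongConvexOn.inner_sub_subdiff (hf : StrongConvexOn univ κ f) {u v u' v' : X}
    (hv : v ∈ subdiff f u) (hv' : v' ∈ subdiff f u') :
    κ * ‖u' - u‖ ^ 2 ≤ inner ℝ (v' - v) (u' - u) := by
  have h1 := hf.le_of_mem_subdiff univ_mem (mem_univ u') hv
  have h2 := hf.le_of_mem_subdiff univ_mem (mem_univ u) hv'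
  rw [norm_sub_rev, ← neg_sub u' u, inner_neg_right] at h2
  rw [inner_sub_left]
  linarith

/-- For `c > -κ` the mapping `∂f + c • id` is onto: the function `f + c / 2 * ‖·‖ ^ 2 - ⟪r, ·⟫` is
continuous and coercive, and the optimality condition at a minimiser is the assertion. -/
theorem _root_.StrongConvexOn.exists_sub_smul_mem_subdiff (hf : StrongConvexOn univ κ f) {c : ℝ}
    (hc : 0 < κ + c) {u v : X} (hv : v ∈ subdiff f u) (r : X) :
    ∃ x, r - c • x ∈ subdiff f x := by
  have hcont : Continuous f := continuousOn_univ.1 (hf.continuousOn isOpen_univ)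
  let h : X → ℝ := fun x => f x + c / 2 * ‖x‖ ^ 2 - inner ℝ r x
  have hh : Continuous h := by fun_prop
  obtain ⟨x, hx⟩ : ∃ x, ∀ y, h x ≤ h y := by
    refine hh.exists_forall_le' u ?_
    have hlow : ∀ y, h u + ‖y - u‖ * ((κ + c) / 2 * ‖y - u‖ - ‖v + c • u - r‖) ≤ h y := by
      intro y
      have h1 := hf.le_of_mem_subdiff univ_mem (mem_univ y) hv
      have h2 : ‖y‖ ^ 2 = ‖u‖ ^ 2 + 2 * inner ℝ u (y - u) + ‖y - u‖ ^ 2 := by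
        rw [← norm_add_sq_real, add_sub_cancel]
      have h3 := neg_le_of_abs_le (abs_real_inner_le_norm (v + c • u - r) (y - u))
      rw [inner_sub_left, inner_add_left, real_inner_smul_left, inner_sub_right r] at h3
      simp only [h, h2]
      linarith
    have ht : Tendsto (fun y : X => ‖y - u‖) (cocompact X) atTop := by
      have := tendsto_norm_cocompact_atTop (E := X)
      refine tendsto_atTop_mono (fun y => ?_) (tendsto_atTop_add_const_right _ (-‖u‖) this)
      have := norm_sub_norm_le y u
      linarith
    filter_upwards [ht.eventually_ge_atTop (‖v + c • u - r‖ / ((κ + c) / 2))] with y hy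
    refine le_trans ?_ (hlow y)
    rw [div_le_iff₀ (by positivity)] at hy
    have := mul_nonneg (norm_nonneg (y - u)) (sub_nonneg.2 hy)
    linarith
  refine ⟨x, mem_subdiff_of_eventually_support (m := -(c / 2)) (Eventually.of_forall fun y => ?_)⟩
  have h1 := hx y
  have h2 : ‖y‖ ^ 2 = ‖x‖ ^ 2 + 2 * inner ℝ x (y - x) + ‖y - x‖ ^ 2 := by
    rw [← norm_add_sq_real, add_sub_cancel]
  rw [inner_sub_left, real_inner_smul_left, inner_sub_right r]
  simp only [h, h2] at h1
  linarith

/-- Strong convexity bounds the regular coderivative of the subdifferential from below. For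
`c > -κ` the graph of `∂f` contains points `(u + a, v + b)` with `b + c • a = t • (z + c • w)`
and `a, b = O(t)`; as `t → 0` the normal inequality at these points gives
`0 ≤ ⟪z + c • w, w⟫`, and then `c` tends to `-κ`. -/
theorem _root_.StrongConvexOn.le_inner_of_mem_combinedSecondSubdiff (hf : StrongConvexOn univ κ f)
    {u v w z : X} (hz : z ∈ combinedSecondSubdiff f u v w) :
    κ * ‖w‖ ^ 2 ≤ inner ℝ z w := by
  obtain ⟨hv, hN⟩ := mem_regularCoderiv_iff.1 hz
  have key : ∀ c : ℝ, 0 < κ + c → 0 ≤ inner ℝ (z + c • w) w := by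
    intro c hc
    set d := z + c • w with hd
    choose x hx using fun t : ℝ => hf.exists_sub_smul_mem_subdiff hc hv (v + c • u + t • d)
    have hb : ∀ t, v + c • u + t • d - c • x t - v = t • d - c • (x t - u) := fun t => by module
    have hmon : ∀ t, (κ + c) * ‖x t - u‖ ^ 2 ≤ t * inner ℝ d (x t - u) := fun t => by
      have h1 := hf.inner_sub_subdiff hv (hx t)
      rw [hb, inner_sub_left, real_inner_smul_left, real_inner_smul_left,
        real_inner_self_eq_norm_sq] at h1
      linarith
    have hxt : ∀ t, 0 < t → ‖x t - u‖ ≤ t * (‖d‖ / (κ + c)) := fun t ht => by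
      rcases (norm_nonneg (x t - u)).eq_or_lt' with h0 | h0
      · rw [h0]; positivity
      have h1 := (hmon t).trans (mul_le_mul_of_nonneg_left (real_inner_le_norm _ _) ht.le)
      rw [mul_div_assoc', le_div_iff₀ hc]
      refine le_of_mul_le_mul_right ?_ h0
      linarith
    set C := ‖d‖ / (κ + c) + (‖d‖ + |c| * (‖d‖ / (κ + c))) with hC
    have hC0 : 0 ≤ C := by positivity
    have hp : ∀ t, 0 < t →
        ‖WithLp.toLp 2 (x t - u, v + c • u + t • d - c • x t - v)‖ ≤ t * C := fun t ht => by
      refine (norm_toLp_prod_le _ _).trans ?_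
      rw [hb]
      have h1 := norm_sub_le (t • d) (c • (x t - u))
      rw [norm_smul, norm_smul, Real.norm_eq_abs, Real.norm_eq_abs, abs_of_pos ht] at h1
      have h2 := mul_le_mul_of_nonneg_left (hxt t ht) (abs_nonneg c)
      have h3 := hxt t ht
      rw [hC]
      linarith
    have hlim : Tendsto (fun t => WithLp.toLp 2 (x t, v + c • u + t • d - c • x t)) (𝓝[>] 0)
        (𝓝 (WithLp.toLp 2 (u, v))) := by
      rw [tendsto_iff_norm_sub_tendsto_zero]
      have h0 : Tendsto (fun t : ℝ => t * C) (𝓝[>] 0) (𝓝 0) := by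
        have : Continuous fun t : ℝ => t * C := by fun_prop
        simpa using (this.tendsto 0).mono_left nhdsWithin_le_nhds
      refine squeeze_zero' (Eventually.of_forall fun t => norm_nonneg _) ?_ h0
      exact eventually_mem_nhdsWithin.mono fun t ht => hp t ht
    have hη : ∀ η : ℝ, 0 < η → -(η * C) ≤ inner ℝ d w := by
      intro η hη
      obtain ⟨t, h1, ht⟩ := ((hlim.eventually (hN η hη)).and eventually_mem_nhdsWithin).exists
      have ht : 0 < t := ht
      have h2 := (h1 (hx t)).trans (mul_le_mul_of_nonneg_left (hp t ht) hη.le)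
      change inner ℝ z (x t - u) - inner ℝ w (v + c • u + t • d - c • x t - v) ≤ _ at h2
      rw [hb, inner_sub_right w, real_inner_smul_right, real_inner_smul_right,
        real_inner_comm d w] at h2
      have h3 : inner ℝ d (x t - u) = inner ℝ z (x t - u) + c * inner ℝ w (x t - u) := by
        rw [hd, inner_add_left, real_inner_smul_left]
      have h4 : 0 ≤ t * inner ℝ d (x t - u) := le_trans (by positivity) (hmon t)
      have h5 : 0 ≤ inner ℝ d (x t - u) := nonneg_of_mul_nonneg_right h4 ht
      refine le_of_mul_le_mul_left ?_ ht
      linarith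
    refine le_of_forall_pos_le_add_mul (C := C) fun η h0 => ?_
    have := hη η h0
    linarith
  refine le_of_forall_pos_le_add_mul (C := ‖w‖ ^ 2) fun ε hε => ?_
  have h1 := key (ε - κ) (by linarith)
  rw [inner_add_left, real_inner_smul_left, real_inner_self_eq_norm_sq] at h1
  linarith

end Necessity

/-! ### Penalized minimization over the graph of the subdifferential -/

section Penalty

variable {X : Type*} [NormedAddCommGroup X] [InnerProductSpace ℝ X]

/-- Fermat's rule: a local minimum over the graph makes minus the gradient a regular normal. -/
theorem mem_regularCoderiv_of_isLocalMin {F : X → Set X} {u v w z : X} (hv : v ∈ F u)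
    {Φ : WithLp 2 (X × X) → ℝ} {Φ' : WithLp 2 (X × X) →L[ℝ] ℝ}
    (hΦ : HasFDerivAt Φ Φ' (WithLp.toLp 2 (u, v)))
    (hzw : ∀ p, Φ' p = inner ℝ w p.snd - inner ℝ z p.fst)
    (hmin : ∀ᶠ p in 𝓝 (WithLp.toLp 2 (u, v)), p.snd ∈ F p.fst → Φ (WithLp.toLp 2 (u, v)) ≤ Φ p) :
    z ∈ regularCoderiv F u v w := by
  refine mem_regularCoderiv_iff.2 ⟨hv, fun η hη => ?_⟩
  filter_upwards [hmin, hΦ.isLittleO.def hη] with p hp hp' hpF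
  have h1 := hp hpF
  have h2 := (le_abs_self _).trans hp'
  rw [hzw] at h2
  change Φ p - Φ (WithLp.toLp 2 (u, v)) - (inner ℝ w (p.snd - v) - inner ℝ z (p.fst - u)) ≤ _ at h2
  linarith

theorem hasFDerivAt_norm_of_ne_zero {x : X} (hx : x ≠ 0) :
    HasFDerivAt (fun y : X => ‖y‖) (innerSL ℝ (‖x‖⁻¹ • x)) x := by
  have h0 : ‖x‖ ≠ 0 := norm_ne_zero_iff.2 hx
  have h := ((hasStrictFDerivAt_norm_sq x).hasFDerivAt).sqrt (pow_ne_zero 2 h0)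
  simp only [Real.sqrt_sq (norm_nonneg _)] at h
  refine h.congr_fderiv ?_
  ext y
  simp
  field_simp

/-- A smooth penalty of slope greater than `1` that is small at `s₁` but dominates a linear function
of slope `C` from `S` onwards; a high power provides it. -/
theorem exists_penalty {s₁ S D C : ℝ} (hs₁ : 0 ≤ s₁) (hS : s₁ < S) (hD : s₁ < D) (hC : 0 ≤ C) :
    ∃ χ χ' : ℝ → ℝ, (∀ s, HasDerivAt χ (χ' s) s) ∧ (∀ s, 0 ≤ s → 1 < χ' s) ∧ χ 0 = 0 ∧
      (∀ s, S ≤ s → C * s < χ s) ∧ χ s₁ < D := by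
  have hS0 : 0 < S := hs₁.trans_lt hS
  obtain ⟨c, hcD, hc⟩ : ∃ c : ℝ, c * s₁ < D ∧ 1 < c := by
    have h1 : Tendsto (fun c : ℝ => c * s₁) (𝓝[>] 1) (𝓝 s₁) := by
      have : Continuous fun c : ℝ => c * s₁ := by fun_prop
      simpa using (this.tendsto 1).mono_left nhdsWithin_le_nhds
    exact ((h1.eventually (gt_mem_nhds hD)).and eventually_mem_nhdsWithin).exists
  obtain ⟨m, hm⟩ : ∃ m : ℕ, c * s₁ + C * s₁ * (s₁ / S) ^ m < D := by
    have h1 := ((tendsto_pow_atTop_nhds_zero_of_lt_one (div_nonneg hs₁ hS0.le)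
      ((div_lt_one hS0).2 hS)).const_mul (C * s₁)).const_add (c * s₁)
    rw [mul_zero, add_zero] at h1
    exact (h1.eventually (gt_mem_nhds hcD)).exists
  refine ⟨fun s => c * s + C / S ^ m * s ^ (m + 1), fun s => c + C / S ^ m * ((m + 1) * s ^ m),
    fun s => ?_, fun s hs => ?_, by simp, fun s hs => ?_, ?_⟩
  · have h1 := ((hasDerivAt_id s).const_mul c).add
      ((hasDerivAt_pow (m + 1) s).const_mul (C / S ^ m))
    exact (h1.congr_deriv (by simp)).congr_of_eventuallyEq (Eventually.of_forall fun _ => rfl)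
  · have : 0 ≤ C / S ^ m * ((m + 1) * s ^ m) := by positivity
    linarith
  · have hs0 : 0 < s := hS0.trans_le hs
    have h1 : C * s ≤ C / S ^ m * s ^ (m + 1) := by
      rw [div_mul_eq_mul_div, le_div_iff₀ (by positivity), pow_succ, mul_assoc, mul_comm s]
      exact mul_le_mul_of_nonneg_left (mul_le_mul_of_nonneg_right
        (pow_le_pow_left₀ hS0.le hs m) hs0.le) hC
    have h2 : 0 < c * s := by positivity
    linarith
  · refine lt_of_eq_of_lt ?_ hm
    rw [div_pow]
    ring

variable [FiniteDimensional ℝ X] {f : X → ℝ} {κ : ℝ}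

/-- The coderivative bound in the rotated coordinates `y = u + lam • v`,
`N = (2 + 2 * κ * lam) • u - y` of the graph, in which it says that the regular subgradients of
`⟪q, N⟫` with respect to `y` have norm at most `‖q‖`. -/
theorem norm_le_of_mem_combinedSecondSubdiff
    (h : ∀ u v w z : X, z ∈ combinedSecondSubdiff f u v w → κ * ‖w‖ ^ 2 ≤ inner ℝ z w)
    (hκ : 0 < κ) {lam : ℝ} (hlam : 0 < lam) {u v q g : X}
    (hg : -((2 + 2 * κ * lam) • q + (g - q)) ∈ combinedSecondSubdiff f u v (lam • (g - q))) :
    ‖g‖ ≤ ‖q‖ := by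
  have h1 := h _ _ _ _ hg
  rw [norm_smul, mul_pow, Real.norm_eq_abs, sq_abs, norm_sub_sq_real, inner_neg_left,
    inner_add_left, real_inner_smul_left, real_inner_smul_right, real_inner_smul_right,
    real_inner_self_eq_norm_sq, norm_sub_sq_real, inner_sub_right,
    real_inner_self_eq_norm_sq, real_inner_comm q g] at h1
  have h2 : (lam * (1 + κ * lam)) * ‖g‖ ^ 2 ≤ (lam * (1 + κ * lam)) * ‖q‖ ^ 2 := by
    linarith
  exact le_of_sq_le_sq (le_of_mul_le_mul_left h2 (by positivity)) (norm_nonneg q)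

/-- The function whose minimum over the graph of `∂f` is examined cannot have a local minimum off
the line `u + lam • v = u₀ + lam • v₀`: the penalty has too steep a slope. -/
theorem not_isLocalMin_penalized
    (h : ∀ u v w z : X, z ∈ combinedSecondSubdiff f u v w → κ * ‖w‖ ^ 2 ≤ inner ℝ z w)
    (hκ : 0 < κ) {lam : ℝ} (hlam : 0 < lam) {χ χ' : ℝ → ℝ} (hχ : ∀ s, HasDerivAt χ (χ' s) s)
    (hχ' : ∀ s, 0 ≤ s → 1 < χ' s) {u₀ v₀ q u v : X} (hq : q ≠ 0) (hv : v ∈ subdiff f u)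
    (hd : (u - u₀) + lam • (v - v₀) ≠ 0) {Φ : WithLp 2 (X × X) → ℝ}
    (hΦ : ∀ p, Φ p = inner ℝ q ((2 + 2 * κ * lam) • (p.fst - u₀) -
      ((p.fst - u₀) + lam • (p.snd - v₀))) + ‖q‖ * χ ‖(p.fst - u₀) + lam • (p.snd - v₀)‖) :
    ¬ ∀ᶠ p in 𝓝 (WithLp.toLp 2 (u, v)), p.snd ∈ subdiff f p.fst →
      Φ (WithLp.toLp 2 (u, v)) ≤ Φ p := by
  intro hmin
  set d := (u - u₀) + lam • (v - v₀) with hd_def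
  have hd0 : 0 < ‖d‖ := norm_pos_iff.2 hd
  have hq0 : 0 < ‖q‖ := norm_pos_iff.2 hq
  set g := (‖q‖ * χ' ‖d‖ * ‖d‖⁻¹) • d with hg
  have hgn : ‖q‖ < ‖g‖ := by
    have h1 := hχ' ‖d‖ hd0.le
    rw [hg, norm_smul, Real.norm_eq_abs, abs_of_pos (by positivity), mul_assoc,
      inv_mul_cancel₀ hd0.ne', mul_one]
    exact lt_mul_of_one_lt_right hq0 h1
  let π₁ : WithLp 2 (X × X) →L[ℝ] X := WithLp.fstL 2 ℝ X X
  let π₂ : WithLp 2 (X × X) →L[ℝ] X := WithLp.sndL 2 ℝ X X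
  have hπ₁ : HasFDerivAt (fun p : WithLp 2 (X × X) => p.fst - u₀) π₁ (WithLp.toLp 2 (u, v)) :=
    π₁.hasFDerivAt.sub_const u₀
  have hπ₂ : HasFDerivAt (fun p : WithLp 2 (X × X) => p.snd - v₀) π₂ (WithLp.toLp 2 (u, v)) :=
    π₂.hasFDerivAt.sub_const v₀
  have hdd := hπ₁.add (hπ₂.const_smul lam)
  have hnorm := (hasFDerivAt_norm_of_ne_zero hd).comp (WithLp.toLp 2 (u, v)) hdd
  have hpen := ((hχ ‖d‖).comp_hasFDerivAt (WithLp.toLp 2 (u, v)) hnorm).const_mul ‖q‖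
  have hlin := (innerSL ℝ q).hasFDerivAt.comp (WithLp.toLp 2 (u, v))
    ((hπ₁.const_smul (2 + 2 * κ * lam)).sub hdd)
  have hder := (hlin.add hpen).congr_of_eventuallyEq (f₁ := Φ)
    (Eventually.of_forall fun p => hΦ p)
  refine hgn.not_ge (norm_le_of_mem_combinedSecondSubdiff h hκ hlam (u := u) (v := v)
    (mem_regularCoderiv_of_isLocalMin hv hder (fun p => ?_) hmin))
  have e1 : π₁ p = p.fst := rfl
  have e2 : π₂ p = p.snd := rfl
  simp [e1, e2, hg, inner_add_left, inner_sub_left, real_inner_smul_left]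
  ring

end Penalty

/-! ### From the coderivative bound to strong monotonicity -/

section Sufficiency

variable {X : Type*} [NormedAddCommGroup X] [InnerProductSpace ℝ X] [FiniteDimensional ℝ X]
  {f : X → ℝ} {κ : ℝ}

/-- The pairs `(u, v)` with `u` in a ball that satisfy the subgradient inequality on a larger ball
form a compact set. -/
theorem isCompact_supportGraph (hf : Continuous f) (R ρ : ℝ) :
    IsCompact {p : WithLp 2 (X × X) | ‖p.fst‖ ≤ R ∧ ∀ x ∈ Metric.closedBall (0 : X) (R + 1),
      f p.fst + inner ℝ p.snd (x - p.fst) - ρ * ‖x - p.fst‖ ^ 2 ≤ f x} := by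
  have hfst : Continuous fun p : WithLp 2 (X × X) => p.fst := (WithLp.fstL 2 ℝ X X).continuous
  have hsnd : Continuous fun p : WithLp 2 (X × X) => p.snd := (WithLp.sndL 2 ℝ X X).continuous
  obtain ⟨M, hM⟩ :=
    (isCompact_closedBall (0 : X) (R + 1)).exists_bound_of_continuousOn hf.continuousOn
  refine Metric.isCompact_of_isClosed_isBounded ?_ ?_
  · refine (isClosed_le hfst.norm continuous_const).inter ?_
    have hset : {p : WithLp 2 (X × X) | ∀ x ∈ Metric.closedBall (0 : X) (R + 1),
        f p.fst + inner ℝ p.snd (x - p.fst) - ρ * ‖x - p.fst‖ ^ 2 ≤ f x} =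
        ⋂ x ∈ Metric.closedBall (0 : X) (R + 1), {p : WithLp 2 (X × X) |
          f p.fst + inner ℝ p.snd (x - p.fst) - ρ * ‖x - p.fst‖ ^ 2 ≤ f x} := by
      ext p; simp
    change IsClosed {p : WithLp 2 (X × X) | ∀ x ∈ Metric.closedBall (0 : X) (R + 1),
      f p.fst + inner ℝ p.snd (x - p.fst) - ρ * ‖x - p.fst‖ ^ 2 ≤ f x}
    rw [hset]
    refine isClosed_iInter fun x => isClosed_iInter fun _ => isClosed_le ?_ continuous_const
    fun_prop
  · refine (Metric.isBounded_closedBall (x := (0 : WithLp 2 (X × X)))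
      (r := R + (2 * M + |ρ| * 1 ^ 2) / 1)).subset fun p hp => ?_
    have hsub : Metric.closedBall p.fst 1 ⊆ Metric.closedBall (0 : X) (R + 1) := fun y hy => by
      rw [mem_closedBall_iff_norm] at hy
      rw [mem_closedBall_zero_iff]
      have h1 := norm_sub_norm_le y p.fst
      linarith [hp.1]
    rw [mem_closedBall_zero_iff]
    exact (norm_toLp_prod_le p.fst p.snd).trans (add_le_add hp.1
      (norm_le_of_support one_pos (fun y hy => hM y (hsub hy)) fun y hy => hp.2 y (hsub hy)))

/-- The bound on the regular coderivative makes `∂f` strongly monotone. In the coordinates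
`y = u + lam • v`, `N = (2 + 2 * κ * lam) • u - y`, strong monotonicity says that `N` is a
nonexpansive function of `y`. If it fails for two points of the graph, then a linear function of
`N`, penalized by the distance to the first of them in `y`, has over the graph a local minimum at
which its gradient is incompatible with the coderivative bound. -/
theorem inner_sub_subdiff_of_le_inner_combinedSecondSubdiff (hf : IsLowerC 2 f) (hκ : 0 < κ)
    (h : ∀ u v w z : X, z ∈ combinedSecondSubdiff f u v w → κ * ‖w‖ ^ 2 ≤ inner ℝ z w)
    {u₀ v₀ u₁ v₁ : X} (hv₀ : v₀ ∈ subdiff f u₀) (hv₁ : v₁ ∈ subdiff f u₁) :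
    κ * ‖u₁ - u₀‖ ^ 2 ≤ inner ℝ (v₁ - v₀) (u₁ - u₀) := by
  by_contra! hlt
  set S := ‖u₁ - u₀‖ + 1 with hS
  set R := ‖u₀‖ + 2 * S with hR
  obtain ⟨ρ, hρ, hsupp⟩ := hf.exists_support_closedBall (R + 1)
  have hS0 : 0 < S := by positivity
  -- `lam` makes `u` a function of `u + lam • v` and leaves `u₁ + lam • v₁` within the distance `S`
  -- of `u₀ + lam • v₀`.
  set lam := (4 * ρ + 2 * ‖v₁ - v₀‖)⁻¹ with hlam_def
  have hden : 0 < 4 * ρ + 2 * ‖v₁ - v₀‖ := by positivity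
  have hlam : 0 < lam := inv_pos.2 hden
  have hlam1 : lam * (4 * ρ + 2 * ‖v₁ - v₀‖) = 1 := inv_mul_cancel₀ hden.ne'
  have hlamρ : lam * (2 * ρ) ≤ 1 / 2 := by
    have := mul_nonneg hlam.le (norm_nonneg (v₁ - v₀))
    linarith
  have hlamv : lam * ‖v₁ - v₀‖ < 1 := by
    have := mul_pos hlam hρ
    have := mul_nonneg hlam.le (norm_nonneg (v₁ - v₀))
    linarith
  set K := {p : WithLp 2 (X × X) | ‖p.fst‖ ≤ R ∧ ∀ x ∈ Metric.closedBall (0 : X) (R + 1),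
      f p.fst + inner ℝ p.snd (x - p.fst) - ρ * ‖x - p.fst‖ ^ 2 ≤ f x} with hK
  have hKcpt : IsCompact K := isCompact_supportGraph hf.continuous R ρ
  have hmemK : ∀ p : WithLp 2 (X × X), p.snd ∈ subdiff f p.fst → ‖p.fst‖ ≤ R → p ∈ K :=
    fun p hp hpR => ⟨hpR, hsupp p.fst
      (by rw [mem_closedBall_zero_iff]; linarith) p.snd hp⟩
  have hKsub : ∀ p ∈ K, p.snd ∈ subdiff f p.fst := fun p hp => by
    refine mem_subdiff_of_eventually_support (m := -ρ) ?_
    have h1 : p.fst ∈ Metric.ball (0 : X) (R + 1) := by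
      rw [mem_ball_zero_iff]; linarith [hp.1]
    filter_upwards [Metric.isOpen_ball.mem_nhds h1] with x hx
    have := hp.2 x (Metric.ball_subset_closedBall hx)
    linarith
  have hu₀R : ‖u₀‖ ≤ R := by rw [hR]; linarith
  have hu₁R : ‖u₁‖ ≤ R := by
    have := norm_sub_norm_le u₁ u₀
    rw [hR]; linarith [norm_nonneg (u₁ - u₀)]
  have hK₀ : WithLp.toLp 2 (u₀, v₀) ∈ K := hmemK _ hv₀ hu₀R
  have hK₁ : WithLp.toLp 2 (u₁, v₁) ∈ K := hmemK _ hv₁ hu₁R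
  let a : WithLp 2 (X × X) → X := fun p => p.fst - u₀
  let d : WithLp 2 (X × X) → X := fun p => (p.fst - u₀) + lam • (p.snd - v₀)
  have ha0 : ∀ p ∈ K, ‖a p‖ ≤ 2 * ‖d p‖ := fun p hp => by
    have h1 := hp.2 u₀ (by rw [mem_closedBall_zero_iff]; linarith)
    have h2 := hK₀.2 p.fst (by rw [mem_closedBall_zero_iff]; linarith [hp.1])
    change f u₀ + inner ℝ v₀ (p.fst - u₀) - ρ * ‖p.fst - u₀‖ ^ 2 ≤ f p.fst at h2
    rw [norm_sub_rev, ← neg_sub p.fst u₀, inner_neg_right] at h1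
    have h3 : ‖a p‖ ^ 2 + lam * (inner ℝ p.snd (a p) - inner ℝ v₀ (a p)) = inner ℝ (d p) (a p) := by
      simp only [d, a, inner_add_left, real_inner_smul_left, inner_sub_left p.snd,
        real_inner_self_eq_norm_sq]
    have h4 : -(2 * ρ * ‖a p‖ ^ 2) ≤ inner ℝ p.snd (a p) - inner ℝ v₀ (a p) := by
      simp only [a]; linarith
    have h5 := mul_le_mul_of_nonneg_left h4 hlam.le
    have h6 := mul_le_mul_of_nonneg_right hlamρ (sq_nonneg ‖a p‖)
    have h7 := real_inner_le_norm (d p) (a p)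
    rcases (norm_nonneg (a p)).eq_or_lt' with h0 | h0
    · rw [h0]; positivity
    refine le_of_mul_le_mul_right ?_ h0
    linarith
  set μ := 2 + 2 * κ * lam with hμ
  have hμ0 : 0 < μ := by positivity
  set d₁ := (u₁ - u₀) + lam • (v₁ - v₀) with hd₁
  set q := -(μ • (u₁ - u₀) - d₁) with hq
  -- This is where strong monotonicity is rewritten as nonexpansiveness.
  have hd₁q : ‖d₁‖ < ‖q‖ := by
    refine lt_of_pow_lt_pow_left₀ 2 (norm_nonneg q) ?_
    rw [hq, norm_neg, norm_sub_sq_real, norm_smul, mul_pow, Real.norm_eq_abs, sq_abs,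
      real_inner_smul_left]
    have h1 : inner ℝ (u₁ - u₀) d₁ = ‖u₁ - u₀‖ ^ 2 + lam * inner ℝ (v₁ - v₀) (u₁ - u₀) := by
      rw [hd₁, inner_add_right, real_inner_smul_right, real_inner_self_eq_norm_sq,
        real_inner_comm (u₁ - u₀)]
    rw [h1]
    have h2 := mul_lt_mul_of_pos_left hlt (by positivity : 0 < 2 * μ * lam)
    rw [hμ] at h2 ⊢
    linarith
  have hq0 : 0 < ‖q‖ := (norm_nonneg d₁).trans_lt hd₁q
  have hd₁S : ‖d₁‖ < S := by
    have h1 := norm_add_le (u₁ - u₀) (lam • (v₁ - v₀))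
    rw [norm_smul, Real.norm_eq_abs, abs_of_pos hlam] at h1
    rw [hS]; linarith
  obtain ⟨χ, χ', hχ, hχ', hχ0, hχS, hχd₁⟩ := exists_penalty (C := 2 * μ + 1)
    (norm_nonneg d₁) hd₁S hd₁q (by positivity)
  have hχc : Continuous χ := continuous_iff_continuousAt.2 fun s => (hχ s).continuousAt
  let Φ : WithLp 2 (X × X) → ℝ := fun p => inner ℝ q (μ • a p - d p) + ‖q‖ * χ ‖d p‖
  have hfst : Continuous fun p : WithLp 2 (X × X) => p.fst := (WithLp.fstL 2 ℝ X X).continuous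
  have hsnd : Continuous fun p : WithLp 2 (X × X) => p.snd := (WithLp.sndL 2 ℝ X X).continuous
  have hΦc : Continuous Φ := by fun_prop
  obtain ⟨p, hpK, hpmin⟩ := hKcpt.exists_isMinOn ⟨_, hK₀⟩ hΦc.continuousOn
  have hΦ₁ : Φ (WithLp.toLp 2 (u₁, v₁)) < 0 := by
    change inner ℝ q (μ • (u₁ - u₀) - d₁) + ‖q‖ * χ ‖d₁‖ < 0
    rw [← neg_neg (μ • (u₁ - u₀) - d₁), ← hq, inner_neg_right, real_inner_self_eq_norm_sq, sq]
    have := mul_lt_mul_of_pos_left hχd₁ hq0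
    linarith
  have hΦp : Φ p < 0 := (hpmin hK₁).trans_lt hΦ₁
  have hlow : -(‖q‖ * ((2 * μ + 1) * ‖d p‖)) ≤ inner ℝ q (μ • a p - d p) := by
    refine le_trans (neg_le_neg ?_) (neg_le_of_abs_le (abs_real_inner_le_norm _ _))
    refine mul_le_mul_of_nonneg_left ?_ (norm_nonneg q)
    have h1 := norm_sub_le (μ • a p) (d p)
    rw [norm_smul, Real.norm_eq_abs, abs_of_pos hμ0] at h1
    have h2 := mul_le_mul_of_nonneg_left (ha0 p hpK) hμ0.le
    linarith
  have hdp : d p ≠ 0 := fun h0 => by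
    have h1 : Φ p = inner ℝ q (μ • a p - d p) + ‖q‖ * χ ‖d p‖ := rfl
    rw [h0, norm_zero] at hlow
    rw [h0, norm_zero, hχ0] at h1
    linarith
  have hdS : ‖d p‖ < S := by
    by_contra! h0
    have h1 := mul_lt_mul_of_pos_left (hχS _ h0) hq0
    have h2 : Φ p = inner ℝ q (μ • a p - d p) + ‖q‖ * χ ‖d p‖ := rfl
    linarith
  have hpR : ‖p.fst‖ < R := by
    have h1 := norm_sub_norm_le p.fst u₀
    have h2 : ‖p.fst - u₀‖ ≤ 2 * ‖d p‖ := ha0 p hpK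
    rw [hR]; linarith
  refine not_isLocalMin_penalized h hκ hlam hχ hχ' (norm_pos_iff.1 hq0) (hKsub p hpK) hdp
    (Φ := Φ) (fun _ => rfl) ?_
  filter_upwards [hfst.norm.continuousAt.eventually_lt_const hpR] with p' hp' hp'g
  exact hpmin (hmemK p' hp'g hp'.le)

/-! ### From strong monotonicity to the subgradient inequality -/

/-- Strong monotonicity of `∂f` upgrades the subgradient inequality of a weakly convex function to
that of a strongly convex one: the weak inequality is summed over `N` equal parts of the
segment from `a` to `b`, where its error is `O(1 / N)`. -/
theorem le_of_inner_sub_subdiff (hf : IsLowerC 2 f)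
    (hmon : ∀ u₀ v₀ u₁ v₁ : X, v₀ ∈ subdiff f u₀ → v₁ ∈ subdiff f u₁ →
      κ * ‖u₁ - u₀‖ ^ 2 ≤ inner ℝ (v₁ - v₀) (u₁ - u₀))
    {a b v : X} (hv : v ∈ subdiff f a) :
    f a + inner ℝ v (b - a) + κ / 2 * ‖b - a‖ ^ 2 ≤ f b := by
  obtain ⟨ρ, hρ, hsupp⟩ := hf.exists_support_closedBall (max ‖a‖ ‖b‖)
  set e := b - a with he
  have key : ∀ N : ℕ, 0 < N → ∀ i : ℕ, i ≤ N →
      f a + i * ((N : ℝ)⁻¹ * inner ℝ v e) + κ * (i * (i - 1) / 2) * ((N : ℝ)⁻¹ ^ 2 * ‖e‖ ^ 2)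
        - i * ρ * ((N : ℝ)⁻¹ ^ 2 * ‖e‖ ^ 2) ≤ f (a + ((i : ℝ) * (N : ℝ)⁻¹) • e) := by
    intro N hN i
    have hN0 : (0 : ℝ) < N := Nat.cast_pos.2 hN
    have hball : ∀ j : ℕ, j ≤ N →
        a + ((j : ℝ) * (N : ℝ)⁻¹) • e ∈ Metric.closedBall (0 : X) (max ‖a‖ ‖b‖) := by
      intro j hj
      refine (convex_closedBall (0 : X) _).add_smul_sub_mem
        (by rw [mem_closedBall_zero_iff]; exact le_max_left _ _)
        (by rw [mem_closedBall_zero_iff]; exact le_max_right _ _) ⟨by positivity, ?_⟩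
      rw [← div_eq_mul_inv, div_le_one hN0]
      exact_mod_cast hj
    induction i with
    | zero => intro _; simp
    | succ i ih =>
      intro hi
      have h0 := ih (by omega)
      -- At the initial point the given subgradient has to be used, since monotonicity does not
      -- compare it with another subgradient there.
      obtain ⟨vi, hvi, h2⟩ : ∃ vi ∈ subdiff f (a + ((i : ℝ) * (N : ℝ)⁻¹) • e),
          κ * (i * ((N : ℝ)⁻¹ ^ 2 * ‖e‖ ^ 2)) ≤ (N : ℝ)⁻¹ * (inner ℝ vi e - inner ℝ v e) := by
        rcases Nat.eq_zero_or_pos i with rfl | hi0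
        · exact ⟨v, by simpa using hv, by simp⟩
        · obtain ⟨vi, hvi⟩ := hf.subdiff_nonempty (a + ((i : ℝ) * (N : ℝ)⁻¹) • e)
          have h3 := hmon _ _ _ _ hv hvi
          rw [add_sub_cancel_left, real_inner_smul_right, norm_smul, mul_pow, Real.norm_eq_abs,
            sq_abs, inner_sub_left] at h3
          have hi0' : (0 : ℝ) < i := Nat.cast_pos.2 hi0
          refine ⟨vi, hvi, le_of_mul_le_mul_left ?_ hi0'⟩
          linarith
      have h1 := hsupp _ (hball i (by omega)) vi hvi _ (hball (i + 1) hi)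
      have e1 : a + (((i + 1 : ℕ) : ℝ) * (N : ℝ)⁻¹) • e - (a + ((i : ℝ) * (N : ℝ)⁻¹) • e) =
          (N : ℝ)⁻¹ • e := by
        push_cast; module
      rw [e1, real_inner_smul_right, norm_smul, mul_pow, Real.norm_eq_abs, sq_abs] at h1
      push_cast at h1 ⊢
      linarith
  have hlim : Tendsto (fun N : ℕ => f b + (N : ℝ)⁻¹ * ((κ / 2 + ρ) * ‖e‖ ^ 2)) atTop
      (𝓝 (f b)) := by
    simpa using (tendsto_inv_atTop_nhds_zero_nat (𝕜 := ℝ)).mul_const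
      ((κ / 2 + ρ) * ‖e‖ ^ 2) |>.const_add (f b)
  refine ge_of_tendsto hlim ((eventually_gt_atTop 0).mono fun N hN => ?_)
  have hN0 : (N : ℝ) ≠ 0 := Nat.cast_ne_zero.2 hN.ne'
  have h1 := key N hN N le_rfl
  rw [mul_inv_cancel₀ hN0, one_smul, he, add_sub_cancel, ← he] at h1
  have h2 : (N : ℝ) * ((N : ℝ)⁻¹ * inner ℝ v e) = inner ℝ v e := by field_simp
  have h3 : κ * ((N : ℝ) * (N - 1) / 2) * ((N : ℝ)⁻¹ ^ 2 * ‖e‖ ^ 2) - N * ρ *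
      ((N : ℝ)⁻¹ ^ 2 * ‖e‖ ^ 2) = κ / 2 * ‖e‖ ^ 2 - (N : ℝ)⁻¹ * ((κ / 2 + ρ) * ‖e‖ ^ 2) := by
    field_simp
    ring
  linarith

end Sufficiency

end VarAnalysis

theorem corollary4p3 (n : ℕ) (f : EuclideanSpace ℝ (Fin n) → ℝ)
    (hf : VarAnalysis.IsLowerC 2 f) (κ : ℝ) (hκ : 0 < κ) :
    List.TFAE [
      StrongConvexOn Set.univ κ f,
      ∀ u v w z : EuclideanSpace ℝ (Fin n), v ∈ VarAnalysis.subdiff f u →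
        z ∈ VarAnalysis.secondSubdiff f u v w → κ * ‖w‖ ^ 2 ≤ inner ℝ z w,
      ∀ u v w z : EuclideanSpace ℝ (Fin n), v ∈ VarAnalysis.subdiff f u →
        z ∈ VarAnalysis.combinedSecondSubdiff f u v w → κ * ‖w‖ ^ 2 ≤ inner ℝ z w] := by
  tfae_have 1 → 3 := fun h u v w z _ hz => h.le_inner_of_mem_combinedSecondSubdiff hz
  tfae_have 3 → 2 := by
    rintro h u v w z - ⟨U, V, W, Z, -, -, hW, hZ, hmem⟩
    refine le_of_tendsto_of_tendsto' ((hW.norm.pow 2).const_mul κ) (hZ.inner (𝕜 := ℝ) hW)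
      fun k => h _ _ _ _ (VarAnalysis.mem_regularCoderiv_iff.1 (hmem k)).1 (hmem k)
  tfae_have 2 → 3 := fun h u v w z hv hz => h u v w z hv
    ⟨fun _ => u, fun _ => v, fun _ => w, fun _ => z, tendsto_const_nhds, tendsto_const_nhds,
      tendsto_const_nhds, tendsto_const_nhds, fun _ => hz⟩
  tfae_have 3 → 1 := by
    intro h
    refine VarAnalysis.strongConvexOn_of_support convex_univ fun a _ => ?_
    obtain ⟨v, hv⟩ := hf.subdiff_nonempty a
    refine ⟨v, fun b _ => VarAnalysis.le_of_inner_sub_subdiff hf (fun u₀ v₀ u₁ v₁ hv₀ hv₁ => ?_) hv⟩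
    exact VarAnalysis.inner_sub_subdiff_of_le_inner_combinedSecondSubdiff hf hκ
      (fun u v w z hz => h u v w z (VarAnalysis.mem_regularCoderiv_iff.1 hz).1 hz) hv₀ hv₁
  tfae_finish
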